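/- All rings are commutative with $1$. For a ring $A$, let $\mathrm{Q}(A)$ be its total ring of fractions and $\overline{A}$ the integral closure of $A$ in $\mathrm{Q}(A)$. Put $$A^{*}=\{\alpha\in\overline{A}\mid \alpha\otimes 1=1\otimes\alpha \text{ in } \overline{A}\otimes_A\overline{A}\},$$ a subring of $\overline{A}$ containing $A$ (the strict closure of $A$ in $\overline{A}$); $A$ is called strictly closed if $A=A^{*}$. Let $\varphi: R\to S$ be a faithfully flat homomorphism of Noetherian rings. Assume that for each homomorphism $R\to R'$ of rings such that $R'$ is a finitely generated $R$-module, the local ring $$[S\otimes_R R']_P/\mathfrak p[S\otimes_R R']_P$$ is regular for every $P\in\operatorname{Spec}(S\otimes_R R')$, where $\mathfrak p=P\cap R'$ is the preimage of $P$ in $R'$. Suppose that $R$ is reduced and that $\overline{R}$ is a finitely generated $R$-module. Let $\beta: S\otimes_R\mathrm{Q}(R)\to\mathrm{Q}(S)$ be the canonical map $s\otimes x\mapsto s\,x$; it is injective. Then the following assertions hold, where, for an $R$-submodule $M$ of $\mathrm{Q}(R)$, $S\otimes_R M$ is regarded as a submodule of $S\otimes_R\mathrm{Q}(R)$ by flatness: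 1. $S$ is reduced. 2. $\beta(S\otimes_R\overline{R})=\overline{S}$ in $\mathrm{Q}(S)$. 3. $\beta(S\otimes_R R^{*})=S^{*}$ in $\mathrm{Q}(S)$. 4. $R$ is strictly closed if and only if $S$ is strictly closed. -/

import Mathlib

open scoped TensorProduct nonZeroDivisors

universe u v

noncomputable section

/-- The strict closure of `R` in an extension `A`: the `R`-subalgebra of those `α : A` with
`α ⊗ 1 = 1 ⊗ α` in `A ⊗[R] A`. -/
def strictClosureIn (R A : Type*) [CommRing R] [CommRing A] [Algebra R A] : Subalgebra R A :=
  AlgHom.equalizer (Algebra.TensorProduct.includeLeft : A →ₐ[R] A ⊗[R] A)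
    (Algebra.TensorProduct.includeRight : A →ₐ[R] A ⊗[R] A)

theorem mem_strictClosureIn_iff {R A : Type*} [CommRing R] [CommRing A] [Algebra R A] (α : A) :
    α ∈ strictClosureIn R A ↔ α ⊗ₜ[R] (1 : A) = (1 : A) ⊗ₜ[R] α :=
  Iff.rfl

/-- `R` is strictly closed in `A`: the strict closure of `R` in `A` is the image of `R`. -/
def IsStrictlyClosedIn (R A : Type*) [CommRing R] [CommRing A] [Algebra R A] : Prop :=
  strictClosureIn R A = ⊥

/-- The integral closure of `R` in its total ring of fractions. -/
abbrev normalization (R : Type*) [CommRing R] : Subalgebra R (FractionRing R) :=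
  integralClosure R (FractionRing R)

/-- The strict closure of `R` in its normalization, viewed inside the total ring of fractions. -/
def strictClosure (R : Type*) [CommRing R] : Subalgebra R (FractionRing R) :=
  (strictClosureIn R (normalization R)).map (normalization R).val

/-- `R` is strictly closed: it is strictly closed in its normalization. -/
def IsStrictlyClosed (R : Type*) [CommRing R] : Prop :=
  IsStrictlyClosedIn R (normalization R)

/-- A flat algebra map sends non-zero-divisors to non-zero-divisors. -/
theorem nonZeroDivisors_le_comap_of_flat (R S : Type*) [CommRing R] [CommRing S] [Algebra R S]
    [Module.Flat R S] : R⁰ ≤ S⁰.comap (algebraMap R S) := by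
  intro r hr
  have h : IsSMulRegular S r := Module.Flat.isSMulRegular_of_nonZeroDivisors hr
  rw [Submonoid.mem_comap, mem_nonZeroDivisors_iff_right]
  intro x hx
  refine h ?_
  simpa [Algebra.smul_def, mul_comm] using hx

/-- The map `Q(R) → Q(S)`, `a / b ↦ a / b`, of total rings of fractions induced by a flat
algebra `R → S`. -/
def fractionRingMap (R S : Type*) [CommRing R] [CommRing S] [Algebra R S] [Module.Flat R S] :
    FractionRing R →ₐ[R] FractionRing S where
  toRingHom := IsLocalization.map (FractionRing S) (algebraMap R S)
    (nonZeroDivisors_le_comap_of_flat R S)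
  commutes' r := by
    simp [IsScalarTower.algebraMap_apply R S (FractionRing S)]

/-- The canonical map `S ⊗[R] Q(R) → Q(S)`, `s ⊗ x ↦ s * x`. -/
def tensorFractionRingMap (R S : Type*) [CommRing R] [CommRing S] [Algebra R S]
    [Module.Flat R S] : S ⊗[R] FractionRing R →ₐ[S] FractionRing S :=
  Algebra.TensorProduct.lift (Algebra.ofId S (FractionRing S)) (fractionRingMap R S)
    fun _ _ => Commute.all _ _

/-- The local fibre `B_P / 𝔭 B_P` of a ring map `f : A → B` at a prime `P` of `B`, where
`𝔭 = P ∩ A` is the preimage of `P` under `f`. -/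
abbrev LocalFibre {A B : Type*} [CommRing A] [CommRing B] (f : A →+* B)
    (P : Ideal B) [P.IsPrime] : Type _ :=
  Localization.AtPrime P ⧸
    (P.comap f).map ((algebraMap B (Localization.AtPrime P)).comp f)

end

/-!
Write `N` for the normalization of `R`. The point is that `B = S ⊗[R] N`, which embeds in `Q(S)`
and is integral over `S`, is reduced and integrally closed; it is then the normalization of `S`.

If `P` is associated to a regular principal ideal of `B` and `𝔭 = P ∩ N` consists of zero divisors,
then `N_𝔭` is a field, so `B_P` is its own local fibre, hence regular of depth one. Otherwise, by
flatness, `𝔭` lies in a prime associated to a regular principal ideal of `N`, so `N_𝔭` is a discrete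
valuation ring, and its uniformizer generates a prime ideal of `B_P` because the local fibre is a
domain. In both cases `B_P` is a discrete valuation ring, and an integral fraction `a / s` lies in
`B` as soon as `s` divides `a` in all these localizations.

The strict closure is the kernel of `α ↦ α ⊗ 1 - 1 ⊗ α`, so it commutes with flat base change, and
faithful flatness reflects its triviality.
-/

open IsLocalRing

section RegularLocalRing

variable {R : Type*} [CommRing R]

theorem eq_bot_of_isPrime_of_le_span_singleton [IsLocalRing R] [IsNoetherianRing R] {x : R}
    (hx : x ∈ maximalIdeal R) {q : Ideal R} [hq : q.IsPrime] (hqx : q ≤ Ideal.span {x})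
    (hxq : x ∉ q) : q = ⊥ := by
  have hle : Ideal.span {x} ≤ maximalIdeal R := (Ideal.span_singleton_le_iff_mem _).2 hx
  refine Submodule.eq_bot_of_le_smul_of_le_jacobson_bot (Ideal.span {x}) q
    (IsNoetherian.noetherian q) (fun y hy => ?_) (hle.trans (maximalIdeal_le_jacobson _))
  obtain ⟨z, rfl⟩ := Ideal.mem_span_singleton.1 (hqx hy)
  exact Submodule.smul_mem_smul (Ideal.mem_span_singleton_self x)
    ((hq.mem_or_mem hy).resolve_left hxq)

theorem isDomain_of_isPrime_span_singleton [IsLocalRing R] [IsNoetherianRing R] {x : R}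
    (hx : x ∈ maximalIdeal R) (hxmin : ∀ q ∈ minimalPrimes R, x ∉ q)
    (hprime : (Ideal.span {x}).IsPrime) : IsDomain R := by
  obtain ⟨q, hq, hqx⟩ := Ideal.exists_minimalPrimes_le (I := ⊥) (J := Ideal.span {x}) bot_le
  have := hq.1.1
  obtain rfl := eq_bot_of_isPrime_of_le_span_singleton hx hqx (hxmin q hq)
  exact IsDomain.of_bot_isPrime R

theorem exists_mem_span_insert_sdiff_singleton [IsLocalRing R] {G : Set R} {x : R}
    (hG : Ideal.span G = maximalIdeal R) (hx : x ∈ maximalIdeal R)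
    (hx2 : x ∉ maximalIdeal R ^ 2) : ∃ g ∈ G, g ∈ Ideal.span (insert x (G \ {g})) := by
  classical
  obtain ⟨c, hcs, hc⟩ := (Submodule.mem_span_set (R := R)).1 (hG ▸ hx : x ∈ Ideal.span G)
  obtain ⟨g, hgc, hgu⟩ : ∃ g ∈ c.support, IsUnit (c g) := by
    by_contra! hnonunit
    refine hx2 ?_
    rw [← hc, pow_two]
    exact Ideal.sum_mem _ fun g hgc => Ideal.mul_mem_mul
      ((mem_maximalIdeal _).2 (hnonunit g hgc)) (hG ▸ Ideal.subset_span (hcs hgc))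
  refine ⟨g, hcs hgc, (Ideal.unit_mul_mem_iff_mem _ hgu).1 ?_⟩
  rw [Finsupp.sum, ← Finset.add_sum_erase _ _ hgc] at hc
  rw [← smul_eq_mul, eq_sub_of_add_eq hc]
  refine sub_mem (Ideal.subset_span (Set.mem_insert _ _)) (Ideal.sum_mem _ fun y hy => ?_)
  obtain ⟨hyg, hyc⟩ := Finset.mem_erase.1 hy
  exact Ideal.mul_mem_left _ _ (Ideal.subset_span (Or.inr ⟨hcs hyc, hyg⟩))

theorem spanFinrank_maximalIdeal_quotient_lt [IsLocalRing R] [IsNoetherianRing R] {x : R}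
    [IsLocalRing (R ⧸ Ideal.span {x})] (hx : x ∈ maximalIdeal R) (hx2 : x ∉ maximalIdeal R ^ 2) :
    (maximalIdeal (R ⧸ Ideal.span {x})).spanFinrank < (maximalIdeal R).spanFinrank := by
  have hfg : (maximalIdeal R).FG := IsNoetherian.noetherian _
  have hfin := Submodule.FG.finite_generators hfg
  set G := (maximalIdeal R).generators
  have hspan : Ideal.span G = maximalIdeal R := (maximalIdeal R).span_generators
  obtain ⟨g, hgG, hg⟩ := exists_mem_span_insert_sdiff_singleton hspan hx hx2
  have hle : maximalIdeal R ≤ Ideal.span (insert x (G \ {g})) := by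
    rw [← hspan, Ideal.span_le]
    intro y hy
    obtain rfl | hyg := eq_or_ne y g
    · exact hg
    · exact Ideal.subset_span (Or.inr ⟨hy, hyg⟩)
  have hmax : maximalIdeal (R ⧸ Ideal.span {x}) =
      Ideal.span (Ideal.Quotient.mk (Ideal.span {x}) '' (G \ {g})) := by
    rw [← map_maximalIdeal_of_surjective _ Ideal.Quotient.mk_surjective]
    refine le_antisymm ((Ideal.map_mono hle).trans_eq ?_) ?_
    · rw [Ideal.map_span, Set.image_insert_eq, Ideal.Quotient.mk_singleton_self,
        Ideal.span_insert_zero]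
    · rw [← Ideal.map_span, ← hspan]
      exact Ideal.map_mono (Ideal.span_mono Set.sdiff_subset)
  rw [hmax, ← Submodule.FG.generators_ncard hfg]
  calc _ ≤ (Ideal.Quotient.mk (Ideal.span {x}) '' (G \ {g})).ncard :=
        Submodule.spanFinrank_span_le_ncard_of_finite (hfin.sdiff.image _)
    _ ≤ (G \ {g}).ncard := Set.ncard_image_le hfin.sdiff
    _ < G.ncard := Set.ncard_sdiff_singleton_lt_of_mem hgG hfin

theorem isLocalRing_quotient_span_singleton [IsLocalRing R] {x : R} (hx : x ∈ maximalIdeal R) :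
    IsLocalRing (R ⧸ Ideal.span {x}) :=
  have : Nontrivial (R ⧸ Ideal.span {x}) := by
    rwa [Ideal.Quotient.nontrivial_iff, Ne, Ideal.span_singleton_eq_top]
  .of_surjective' _ Ideal.Quotient.mk_surjective

variable [IsRegularLocalRing R]

theorem isRegularLocalRing_quotient_span_singleton {x : R} (hx : x ∈ maximalIdeal R)
    (hx2 : x ∉ maximalIdeal R ^ 2) : IsRegularLocalRing (R ⧸ Ideal.span {x}) := by
  have := isLocalRing_quotient_span_singleton hx
  apply IsRegularLocalRing.of_spanFinrank_maximalIdeal_le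
  obtain ⟨n, hn⟩ : ∃ n : ℕ, ringKrullDim (R ⧸ Ideal.span {x}) = n := by
    have h := Ideal.height_ne_top (maximalIdeal.isMaximal (R ⧸ Ideal.span {x})).ne_top
    exact ⟨_, by rw [← maximalIdeal_height_eq_ringKrullDim, ← ENat.natCast_toNat h]; rfl⟩
  have hlt := spanFinrank_maximalIdeal_quotient_lt hx hx2
  have hdim : ringKrullDim R ≤ ringKrullDim (R ⧸ Ideal.span {x}) + 1 := by
    simpa using ringKrullDim_le_ringKrullDim_quotient_add_encard {x}
      (by simpa [ringJacobson_eq_maximalIdeal] using hx)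
  rw [← (isRegularLocalRing_iff R).1 inferInstance, hn] at hdim
  rw [hn]
  norm_cast at hdim ⊢
  omega

theorem exists_mem_maximalIdeal_notMem_minimalPrimes (hR : ¬ IsField R) :
    ∃ x ∈ maximalIdeal R, x ∉ maximalIdeal R ^ 2 ∧ ∀ q ∈ minimalPrimes R, x ∉ q := by
  have hbot : maximalIdeal R ≠ ⊥ := fun h => hR (isField_iff_maximalIdeal_eq.2 h)
  have hmin : maximalIdeal R ∉ minimalPrimes R := fun h => by
    have hreg := (isRegularLocalRing_iff R).1 inferInstance
    rw [← maximalIdeal_height_eq_ringKrullDim, Ideal.height_eq_zero_iff.2 h] at hreg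
    exact hbot ((Submodule.spanFinrank_eq_zero_iff_eq_bot (IsNoetherian.noetherian _)).1
      (by exact_mod_cast hreg))
  have hsq : maximalIdeal R ≠ maximalIdeal R ^ 2 := fun h =>
    hbot (Submodule.eq_bot_of_le_smul_of_le_jacobson_bot (maximalIdeal R) _
      (IsNoetherian.noetherian _) (by rw [smul_eq_mul, ← pow_two]; exact h.le)
      (maximalIdeal_le_jacobson _))
  have htop : maximalIdeal R ^ 2 ≠ ⊤ := fun h => (maximalIdeal.isMaximal R).ne_top
    (top_le_iff.1 (h ▸ Ideal.pow_le_self two_ne_zero))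
  have hnot : ¬ ((maximalIdeal R : Set R) ⊆
      ⋃ I ∈ insert (maximalIdeal R ^ 2) (minimalPrimes R), (I : Set R)) := fun h =>
    ((Ideal.subset_iUnion_iff_mem_of_isMaximal_of_finite
      ((minimalPrimes.finite_of_isNoetherianRing R).insert _) _ _
      (fun I hI hI2 _ => (hI.resolve_left hI2).1.1) htop htop).1 h).elim hsq hmin
  obtain ⟨x, hx, hxs⟩ := Set.not_subset.1 hnot
  simp only [Set.mem_iUnion, not_exists] at hxs
  exact ⟨x, hx, hxs _ (Set.mem_insert _ _), fun q hq => hxs q (Set.mem_insert_of_mem _ hq)⟩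

variable (R) in
theorem isDomain_of_isRegularLocalRing : IsDomain R := by
  induction hd : (maximalIdeal R).spanFinrank using Nat.strong_induction_on generalizing R with
  | _ d ih =>
  by_cases hR : IsField R
  · exact hR.isDomain
  obtain ⟨x, hx, hx2, hxmin⟩ := exists_mem_maximalIdeal_notMem_minimalPrimes hR
  have := isRegularLocalRing_quotient_span_singleton hx hx2
  have hdom := ih _ (hd ▸ spanFinrank_maximalIdeal_quotient_lt hx hx2) (R ⧸ Ideal.span {x}) rfl
  exact isDomain_of_isPrime_span_singleton hx hxmin ((Ideal.Quotient.isDomain_iff_prime _).1 hdom)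

theorem exists_prime_of_isRegularLocalRing (hR : ¬ IsField R) : ∃ x : R, Prime x := by
  obtain ⟨x, hx, hx2, -⟩ := exists_mem_maximalIdeal_notMem_minimalPrimes hR
  have := isRegularLocalRing_quotient_span_singleton hx hx2
  have hdom := isDomain_of_isRegularLocalRing (R ⧸ Ideal.span {x})
  have hx0 : x ≠ 0 := fun h => hx2 (h ▸ zero_mem _)
  exact ⟨x, (Ideal.span_singleton_prime hx0).1 ((Ideal.Quotient.isDomain_iff_prime _).1 hdom)⟩

end RegularLocalRing

section AssociatedPrime

variable {A : Type*} [CommRing A]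

theorem mem_colon_bot_quotient_span_singleton {s a t : A} :
    a ∈ (⊥ : Submodule A (A ⧸ Ideal.span {s})).colon {Ideal.Quotient.mk (Ideal.span {s}) t} ↔
      s ∣ a * t := by
  rw [Submodule.mem_colon_singleton, Submodule.mem_bot, ← Ideal.mem_span_singleton,
    ← Ideal.Quotient.eq_zero_iff_mem, map_mul]
  rfl

theorem isAssociatedPrime_quotient_span_singleton_iff [IsNoetherianRing A] {P : Ideal A} {s : A} :
    IsAssociatedPrime P (A ⧸ Ideal.span {s}) ↔ P.IsPrime ∧ ∃ t, ∀ a, a ∈ P ↔ s ∣ a * t := by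
  rw [isAssociatedPrime_iff, Ideal.Quotient.mk_surjective.exists]
  simp only [SetLike.ext_iff, mem_colon_bot_quotient_span_singleton]

theorem not_dvd_of_forall_mem_iff_dvd_mul {P : Ideal A} [hP : P.IsPrime] {s t : A}
    (hPt : ∀ a, a ∈ P ↔ s ∣ a * t) : ¬ s ∣ t :=
  fun h => hP.one_notMem ((hPt 1).2 (by rwa [one_mul]))

theorem mem_of_isAssociatedPrime [IsNoetherianRing A] {P : Ideal A} {s : A}
    (hP : IsAssociatedPrime P (A ⧸ Ideal.span {s})) : s ∈ P := by
  obtain ⟨-, t, hPt⟩ := isAssociatedPrime_quotient_span_singleton_iff.1 hP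
  exact (hPt s).2 (dvd_mul_right s t)

theorem algebraMap_dvd_algebraMap_iff (P : Ideal A) [hP : P.IsPrime] {s b : A} :
    algebraMap A (Localization.AtPrime P) s ∣ algebraMap A (Localization.AtPrime P) b ↔
      ∃ m ∉ P, s ∣ m * b := by
  constructor
  · rintro ⟨c, hc⟩
    obtain ⟨⟨d, m⟩, hd⟩ := IsLocalization.surj P.primeCompl c
    have hmb : algebraMap A (Localization.AtPrime P) (m * b) = algebraMap A _ (s * d) := by
      rw [map_mul, map_mul, hc, ← hd]
      ring
    obtain ⟨n, hn⟩ := (IsLocalization.eq_iff_exists P.primeCompl _).1 hmb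
    exact ⟨n * m, (n * m).2, n * d, by linear_combination hn⟩
  · rintro ⟨m, hm, h⟩
    have hunit : IsUnit (algebraMap A (Localization.AtPrime P) m) :=
      IsLocalization.map_units _ (⟨m, hm⟩ : P.primeCompl)
    rw [← hunit.dvd_mul_left, ← map_mul]
    exact map_dvd _ h

theorem dvd_of_forall_isAssociatedPrime [IsNoetherianRing A] {s b : A}
    (h : ∀ (P : Ideal A) [P.IsPrime], IsAssociatedPrime P (A ⧸ Ideal.span {s}) →
      algebraMap A (Localization.AtPrime P) s ∣ algebraMap A (Localization.AtPrime P) b) :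
    s ∣ b := by
  by_contra hsb
  have hb : Ideal.Quotient.mk (Ideal.span {s}) b ≠ 0 := by
    rwa [Ne, Ideal.Quotient.eq_zero_iff_mem, Ideal.mem_span_singleton]
  obtain ⟨P, hP, hbP⟩ := exists_le_isAssociatedPrime_of_isNoetherianRing A _ hb
  have := hP.isPrime
  obtain ⟨m, hmP, hmb⟩ := (algebraMap_dvd_algebraMap_iff P).1 (h P hP)
  exact hmP (hbP (mem_colon_bot_quotient_span_singleton.2 hmb))

theorem isAssociatedPrime_maximalIdeal_localization [IsNoetherianRing A] {P : Ideal A}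
    [P.IsPrime] {s : A} (hP : IsAssociatedPrime P (A ⧸ Ideal.span {s})) :
    IsAssociatedPrime (maximalIdeal (Localization.AtPrime P))
      (Localization.AtPrime P ⧸ Ideal.span {algebraMap A (Localization.AtPrime P) s}) := by
  obtain ⟨hPprime, t, hPt⟩ := isAssociatedPrime_quotient_span_singleton_iff.1 hP
  refine isAssociatedPrime_quotient_span_singleton_iff.2
    ⟨inferInstance, algebraMap A _ t, fun y => ?_⟩
  obtain ⟨⟨a, m⟩, hy⟩ := IsLocalization.surj P.primeCompl y
  have hunit := IsLocalization.map_units (Localization.AtPrime P) m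
  rw [← Ideal.mul_unit_mem_iff_mem _ hunit, hy, IsLocalization.AtPrime.to_map_mem_maximal_iff _ P,
    ← hunit.dvd_mul_right, mul_right_comm, hy, ← map_mul, algebraMap_dvd_algebraMap_iff]
  refine ⟨fun ha => ⟨1, hPprime.one_notMem, by rw [one_mul]; exact (hPt a).1 ha⟩, ?_⟩
  rintro ⟨n, hn, h⟩
  exact (hPprime.mem_or_mem ((hPt (n * a)).2 (by rwa [mul_assoc]))).resolve_left hn

theorem isAssociatedPrime_quotient_span_singleton_of_mem [IsNoetherianRing A] {P : Ideal A}
    {s x : A} (hs : s ∈ A⁰) (hx : x ∈ A⁰) (hxP : x ∈ P)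
    (hP : IsAssociatedPrime P (A ⧸ Ideal.span {s})) : IsAssociatedPrime P (A ⧸ Ideal.span {x}) := by
  obtain ⟨hPprime, t, hPt⟩ := isAssociatedPrime_quotient_span_singleton_iff.1 hP
  obtain ⟨u, hu⟩ := (hPt x).1 hxP
  refine isAssociatedPrime_quotient_span_singleton_iff.2 ⟨hPprime, u, fun a => ?_⟩
  rw [hPt]
  -- `x * t = s * u`, so that `a * t = s * c` and `a * u = x * c` are equivalent
  refine exists_congr fun c => ⟨fun hc => ?_, fun hc => ?_⟩
  · exact (mul_cancel_right_mem_nonZeroDivisors hs).1 (by linear_combination x * hc - a * hu)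
  · exact (mul_cancel_right_mem_nonZeroDivisors hx).1 (by linear_combination s * hc + a * hu)

theorem exists_isAssociatedPrime_ge [IsNoetherianRing A] {x : A} {p : Ideal A}
    (hp : ∀ y ∈ p, ∃ a, x ∣ y * a ∧ ¬ x ∣ a) :
    ∃ Q, IsAssociatedPrime Q (A ⧸ Ideal.span {x}) ∧ p ≤ Q := by
  have hsub : (p : Set A) ⊆ ⋃ Q ∈ associatedPrimes A (A ⧸ Ideal.span {x}), (Q : Set A) := by
    intro y hy
    obtain ⟨a, hya, ha⟩ := hp y hy
    rw [biUnion_associatedPrimes_eq_zero_divisors]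
    refine ⟨Ideal.Quotient.mk _ a, ?_, ?_⟩
    · rwa [Ne, Ideal.Quotient.eq_zero_iff_mem, Ideal.mem_span_singleton]
    · rwa [← Submodule.mem_bot A, ← Submodule.mem_colon_singleton,
        mem_colon_bot_quotient_span_singleton]
  exact (Ideal.subset_union_prime_finite (associatedPrimes.finite A (A ⧸ Ideal.span {x})) ⊤ ⊤
    (fun Q hQ _ _ => hQ.isPrime)).1 hsub

variable {B : Type*} [CommRing B] [Algebra A B] [Module.Flat A B]

theorem algebraMap_dvd_of_dvd_mul_of_flat {x y : A} (hxy : ∀ a, x ∣ y * a → x ∣ a) {b : B}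
    (hb : algebraMap A B x ∣ algebraMap A B y * b) : algebraMap A B x ∣ b := by
  obtain ⟨c, hc⟩ := hb
  have hrel : ∑ i, (![y, -x] : Fin 2 → A) i • (![b, c] : Fin 2 → B) i = 0 := by
    simp [Fin.sum_univ_two, Algebra.smul_def, hc]
  obtain ⟨_, a, z, hbz, haz⟩ :=
    Module.Flat.isTrivialRelation_of_sum_smul_eq_zero (R := A) (M := B) hrel
  rw [show b = ∑ j, a 0 j • z j from hbz 0]
  refine Finset.dvd_sum fun j _ => ?_
  have hj := haz j
  simp only [Fin.sum_univ_two, Matrix.cons_val_zero, Matrix.cons_val_one] at hj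
  rw [Algebra.smul_def]
  exact (map_dvd _ (hxy (a 0 j) ⟨a 1 j, by linear_combination hj⟩)).mul_right _

theorem exists_isAssociatedPrime_comap_le [IsNoetherianRing A] [IsNoetherianRing B] {x : A}
    {P : Ideal B} (hP : IsAssociatedPrime P (B ⧸ Ideal.span {algebraMap A B x})) :
    ∃ Q, IsAssociatedPrime Q (A ⧸ Ideal.span {x}) ∧ P.comap (algebraMap A B) ≤ Q := by
  obtain ⟨hPprime, t, hPt⟩ := isAssociatedPrime_quotient_span_singleton_iff.1 hP
  refine exists_isAssociatedPrime_ge fun y hy => ?_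
  by_contra! hxy
  exact not_dvd_of_forall_mem_iff_dvd_mul hPt (algebraMap_dvd_of_dvd_mul_of_flat hxy ((hPt _).1 hy))

end AssociatedPrime

section DiscreteValuationRing

variable {L : Type*} [CommRing L] [IsLocalRing L] [IsNoetherianRing L]

theorem isDiscreteValuationRing_of_maximalIdeal_eq_span {x : L} (hx : x ∈ L⁰)
    (hmax : maximalIdeal L = Ideal.span {x}) :
    ∃ _ : IsDomain L, IsDiscreteValuationRing L := by
  have hxm : x ∈ maximalIdeal L := hmax ▸ Ideal.mem_span_singleton_self x
  have hdom : IsDomain L := isDomain_of_isPrime_span_singleton hxm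
    (fun q hq hxq => Set.disjoint_left.1
      (Ideal.disjoint_nonZeroDivisors_of_mem_minimalPrimes hq) hxq hx)
    (hmax ▸ (maximalIdeal.isMaximal L).isPrime)
  have hfield : ¬ IsField L := fun h => nonZeroDivisors.ne_zero hx
    (Ideal.mem_bot.1 (isField_iff_maximalIdeal_eq.1 h ▸ hxm))
  have hprincipal : (maximalIdeal L).IsPrincipal := ⟨x, hmax⟩
  exact ⟨hdom, ((IsDiscreteValuationRing.TFAE L hfield).out 4 0).1 hprincipal⟩

theorem isDiscreteValuationRing_of_isAssociatedPrime_maximalIdeal {s x : L} (hs : s ∈ L⁰)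
    (hassoc : IsAssociatedPrime (maximalIdeal L) (L ⧸ Ideal.span {s})) (hx : x ∈ L⁰)
    (hprime : (Ideal.span {x}).IsPrime) :
    ∃ _ : IsDomain L, IsDiscreteValuationRing L := by
  have hxm : Ideal.span {x} ≤ maximalIdeal L := le_maximalIdeal hprime.ne_top
  obtain ⟨-, t, ht⟩ := isAssociatedPrime_quotient_span_singleton_iff.1
    (isAssociatedPrime_quotient_span_singleton_of_mem hs hx
      ((Ideal.span_singleton_le_iff_mem _).1 hxm) hassoc)
  refine isDiscreteValuationRing_of_maximalIdeal_eq_span hx (le_antisymm (fun y hy => ?_) hxm)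
  refine (hprime.mem_or_mem (Ideal.mem_span_singleton.2 ((ht y).1 hy))).resolve_right fun h => ?_
  exact not_dvd_of_forall_mem_iff_dvd_mul ht (Ideal.mem_span_singleton.1 h)

end DiscreteValuationRing

section IsIntegrallyClosed

variable {A : Type*} [CommRing A]

theorem dvd_of_forall_exists_mul_eq_mul [IsNoetherianRing A] [IsIntegrallyClosed A] {I : Ideal A}
    {x t : A} (hx : x ∈ A⁰) (hxI : x ∈ I) (h : ∀ q ∈ I, ∃ a ∈ I, q * t = x * a) : x ∣ t := by
  have hunit : IsUnit (algebraMap A (FractionRing A) x) :=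
    IsLocalization.map_units _ (⟨x, hx⟩ : A⁰)
  -- `I` absorbs multiplication by `t / x`, which is therefore almost integral over `A`
  set z : FractionRing A := IsLocalization.mk' _ t (⟨x, hx⟩ : A⁰)
  have hxz : algebraMap A (FractionRing A) x * z = algebraMap A _ t :=
    IsLocalization.mk'_spec' _ t (⟨x, hx⟩ : A⁰)
  have hpow (n : ℕ) : ∃ q ∈ I, algebraMap A (FractionRing A) q = x • z ^ n := by
    induction n with
    | zero => exact ⟨x, hxI, by simp [Algebra.smul_def]⟩
    | succ n ih =>
      obtain ⟨q, hq, hqn⟩ := ih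
      obtain ⟨a, ha, hqa⟩ := h q hq
      refine ⟨a, ha, hunit.mul_left_cancel ?_⟩
      rw [← map_mul, ← hqa, map_mul, hqn, ← hxz, Algebra.smul_def, Algebra.smul_def]
      ring
  have hint : IsIntegral A z := by
    refine IsAlmostIntegral.isIntegral_of_nonZeroDivisors_le_comap
      ⟨x, hx, fun n => (hpow n).imp fun q hq => hq.2⟩ fun y hy => ?_
    exact (IsLocalization.map_units (FractionRing A) (⟨y, hy⟩ : A⁰)).mem_nonZeroDivisors
  obtain ⟨a, ha⟩ := IsIntegrallyClosedIn.algebraMap_eq_of_integral hint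
  refine ⟨a, IsFractionRing.injective A (FractionRing A) ?_⟩
  rw [← hxz, ← ha, map_mul]

theorem isDiscreteValuationRing_localization_of_isIntegrallyClosed [IsNoetherianRing A]
    [IsIntegrallyClosed A] {Q : Ideal A} [Q.IsPrime] {x : A} (hx : x ∈ A⁰)
    (hQ : IsAssociatedPrime Q (A ⧸ Ideal.span {x})) :
    ∃ _ : IsDomain (Localization.AtPrime Q), IsDiscreteValuationRing (Localization.AtPrime Q) := by
  obtain ⟨-, t, hQt⟩ := isAssociatedPrime_quotient_span_singleton_iff.1 hQ
  obtain ⟨c, hc, w, hw, hcw⟩ : ∃ c ∈ Q, ∃ w ∉ Q, c * t = x * w := by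
    by_contra! h
    refine not_dvd_of_forall_mem_iff_dvd_mul hQt
      (dvd_of_forall_exists_mul_eq_mul hx (mem_of_isAssociatedPrime hQ) fun q hq => ?_)
    obtain ⟨a, ha⟩ := (hQt q).1 hq
    exact ⟨a, by_contra fun haQ => h q hq a haQ ha, ha⟩
  have hdvd (q : A) (hq : q ∈ Q) :
      algebraMap A (Localization.AtPrime Q) c ∣ algebraMap A _ q := by
    obtain ⟨a, ha⟩ := (hQt q).1 hq
    refine (algebraMap_dvd_algebraMap_iff Q).2 ⟨w, hw, a, ?_⟩
    exact (mul_cancel_right_mem_nonZeroDivisors hx).1 (by linear_combination c * ha - q * hcw)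
  have hcreg : algebraMap A (Localization.AtPrime Q) c ∈ (Localization.AtPrime Q)⁰ := by
    obtain ⟨d, hd⟩ := hdvd x (mem_of_isAssociatedPrime hQ)
    have hxreg := nonZeroDivisors_le_comap_of_flat A (Localization.AtPrime Q) hx
    rw [Submonoid.mem_comap, hd] at hxreg
    exact (mul_mem_nonZeroDivisors.1 hxreg).1
  refine isDiscreteValuationRing_of_maximalIdeal_eq_span hcreg (le_antisymm ?_ ?_)
  · rw [← Localization.AtPrime.map_eq_maximalIdeal, Ideal.map_le_iff_le_comap]
    exact fun q hq => Ideal.mem_span_singleton.2 (hdvd q hq)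
  · exact (Ideal.span_singleton_le_iff_mem _).2
      ((IsLocalization.AtPrime.to_map_mem_maximal_iff _ Q c).2 hc)

theorem eq_of_le_of_isDiscreteValuationRing_localization {p Q : Ideal A} [hp : p.IsPrime]
    [hQ : Q.IsPrime] [IsDomain (Localization.AtPrime Q)]
    [IsDiscreteValuationRing (Localization.AtPrime Q)] (hpQ : p ≤ Q) {x : A} (hx : x ∈ A⁰)
    (hxp : x ∈ p) : p = Q := by
  have hdisj : Disjoint (Q.primeCompl : Set A) p :=
    Set.disjoint_left.2 fun a ha hap => ha (hpQ hap)
  have hprime := IsLocalization.isPrime_of_isPrime_disjoint Q.primeCompl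
    (Localization.AtPrime Q) p hp hdisj
  have hne : p.map (algebraMap A (Localization.AtPrime Q)) ≠ ⊥ := fun h =>
    nonZeroDivisors.ne_zero (nonZeroDivisors_le_comap_of_flat A (Localization.AtPrime Q) hx)
      (Ideal.mem_bot.1 (h ▸ Ideal.mem_map_of_mem _ hxp))
  have hmax := eq_maximalIdeal (hprime.isMaximal hne)
  rw [← IsLocalization.under_map_of_isPrime_disjoint Q.primeCompl (Localization.AtPrime Q) hp hdisj,
    hmax, Localization.AtPrime.under_maximalIdeal]

theorem isIntegrallyClosed_of_forall_localization [IsNoetherianRing A]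
    (h : ∀ s ∈ A⁰, ∀ (P : Ideal A) [P.IsPrime], IsAssociatedPrime P (A ⧸ Ideal.span {s}) →
      IsIntegrallyClosed (Localization.AtPrime P)) : IsIntegrallyClosed A := by
  refine (isIntegrallyClosed_iff (FractionRing A)).2 fun {z} hz => ?_
  obtain ⟨⟨b, s⟩, hzs⟩ := IsLocalization.surj A⁰ z
  have hsb : (s : A) ∣ b := dvd_of_forall_isAssociatedPrime fun P _ hP => by
    have := h s s.2 P hP
    obtain ⟨c, hc⟩ := IsIntegrallyClosedIn.algebraMap_eq_of_integral
      ((hz.map (fractionRingMap A (Localization.AtPrime P))).tower_top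
        (A := Localization.AtPrime P))
    refine ⟨c, IsFractionRing.injective _ (FractionRing (Localization.AtPrime P)) ?_⟩
    have hmap := congrArg (fractionRingMap A (Localization.AtPrime P)) hzs
    rw [map_mul, AlgHom.commutes, AlgHom.commutes, ← hc, mul_comm] at hmap
    rw [map_mul, ← IsScalarTower.algebraMap_apply, ← IsScalarTower.algebraMap_apply, hmap]
  obtain ⟨c, rfl⟩ := hsb
  refine ⟨c, (IsLocalization.map_units (FractionRing A) s).mul_right_cancel ?_⟩
  rw [hzs, map_mul, mul_comm]

end IsIntegrallyClosed

section RegularLocalFibres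

variable {A B : Type*} [CommRing A] [CommRing B] [Algebra A B]

theorem exists_notMem_forall_mul_eq_zero [IsNoetherianRing A] [IsReduced A] {p : Ideal A}
    (hp : Disjoint (p : Set A) A⁰) : ∃ w ∉ p, ∀ q ∈ p, w * q = 0 := by
  obtain ⟨w, hw, hw0⟩ :=
    SetLike.exists_of_lt (Ideal.bot_lt_annihilator_of_disjoint_nonZeroDivisors hp)
  have hann (q : A) (hq : q ∈ p) : w * q = 0 := by
    simpa using Submodule.mem_annihilator.1 hw q hq
  exact ⟨w, fun hwp => hw0 ((pow_eq_zero_iff two_ne_zero).1 ((sq w).trans (hann w hwp))), hann⟩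

theorem isRegularLocalRing_localization_of_disjoint [IsNoetherianRing A] [IsReduced A]
    {P : Ideal B} [P.IsPrime] [IsRegularLocalRing (LocalFibre (algebraMap A B) P)]
    (hP : Disjoint (P.comap (algebraMap A B) : Set A) A⁰) :
    IsRegularLocalRing (Localization.AtPrime P) := by
  obtain ⟨w, hw, hzero⟩ := exists_notMem_forall_mul_eq_zero hP
  have hunit : IsUnit (algebraMap B (Localization.AtPrime P) (algebraMap A B w)) :=
    IsLocalization.map_units _ (⟨_, hw⟩ : P.primeCompl)
  have hbot : (P.comap (algebraMap A B)).map
      ((algebraMap B (Localization.AtPrime P)).comp (algebraMap A B)) = ⊥ := by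
    rw [eq_bot_iff, Ideal.map_le_iff_le_comap]
    intro q hq
    rw [Ideal.mem_comap, Ideal.mem_bot, ← hunit.mul_right_eq_zero, RingHom.comp_apply, ← map_mul,
      ← map_mul, hzero q hq, map_zero, map_zero]
  exact IsRegularLocalRing.of_ringEquiv
    ((Ideal.quotEquivOfEq hbot).trans (RingEquiv.quotientBot (Localization.AtPrime P)))

theorem map_comap_eq_span_localRingHom {P : Ideal B} [P.IsPrime]
    {ϖ : Localization.AtPrime (P.comap (algebraMap A B))}
    (hϖ : maximalIdeal (Localization.AtPrime (P.comap (algebraMap A B))) = Ideal.span {ϖ}) :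
    (P.comap (algebraMap A B)).map
      ((algebraMap B (Localization.AtPrime P)).comp (algebraMap A B)) =
      Ideal.span {Localization.localRingHom _ P (algebraMap A B) rfl ϖ} := by
  rw [← Set.image_singleton, ← Ideal.map_span, ← hϖ, ← Localization.AtPrime.map_eq_maximalIdeal,
    Ideal.map_map]
  congr 1
  ext a
  exact (Localization.localRingHom_to_map _ P (algebraMap A B) rfl a).symm

variable [IsNoetherianRing A] [IsNoetherianRing B]

theorem isDiscreteValuationRing_localization_of_disjoint [IsReduced A] {P : Ideal B}
    [P.IsPrime] [IsRegularLocalRing (LocalFibre (algebraMap A B) P)] {s : B} (hs : s ∈ B⁰)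
    (hP : IsAssociatedPrime P (B ⧸ Ideal.span {s}))
    (hdisj : Disjoint (P.comap (algebraMap A B) : Set A) A⁰) :
    ∃ _ : IsDomain (Localization.AtPrime P), IsDiscreteValuationRing (Localization.AtPrime P) := by
  have hs' := nonZeroDivisors_le_comap_of_flat B (Localization.AtPrime P) hs
  have hassoc := isAssociatedPrime_maximalIdeal_localization hP
  have := isRegularLocalRing_localization_of_disjoint hdisj
  have := isDomain_of_isRegularLocalRing (Localization.AtPrime P)
  have hfield : ¬ IsField (Localization.AtPrime P) := fun h => nonZeroDivisors.ne_zero hs'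
    (Ideal.mem_bot.1 (isField_iff_maximalIdeal_eq.1 h ▸ mem_of_isAssociatedPrime hassoc))
  obtain ⟨x, hx⟩ := exists_prime_of_isRegularLocalRing hfield
  exact isDiscreteValuationRing_of_isAssociatedPrime_maximalIdeal hs' hassoc
    (mem_nonZeroDivisors_of_ne_zero hx.ne_zero) ((Ideal.span_singleton_prime hx.ne_zero).2 hx)

variable [Module.Flat A B]

theorem isReduced_of_isRegularLocalRing_localFibre [IsReduced A]
    (hfib : ∀ (P : Ideal B) [P.IsPrime], IsRegularLocalRing (LocalFibre (algebraMap A B) P)) :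
    IsReduced B := by
  refine ⟨fun b hb => zero_dvd_iff.1 (dvd_of_forall_isAssociatedPrime fun P _ hP => ?_)⟩
  obtain ⟨-, t, hPt⟩ := isAssociatedPrime_quotient_span_singleton_iff.1 hP
  have hdisj : Disjoint (P.comap (algebraMap A B) : Set A) A⁰ :=
    Set.disjoint_left.2 fun x hxP hx => not_dvd_of_forall_mem_iff_dvd_mul hPt <| by
      have hxB : algebraMap A B x ∈ B⁰ := nonZeroDivisors_le_comap_of_flat A B hx
      rw [zero_dvd_iff, ← mul_right_mem_nonZeroDivisors_eq_zero_iff hxB, mul_comm]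
      exact zero_dvd_iff.1 ((hPt _).1 hxP)
  have := hfib P
  have := isRegularLocalRing_localization_of_disjoint hdisj
  have := isDomain_of_isRegularLocalRing (Localization.AtPrime P)
  rw [map_zero, zero_dvd_iff, (hb.map (algebraMap B (Localization.AtPrime P))).eq_zero]

theorem isDiscreteValuationRing_localization_comap [IsIntegrallyClosed A] {P : Ideal B}
    [P.IsPrime] {s : B} (hs : s ∈ B⁰)
    (hP : IsAssociatedPrime P (B ⧸ Ideal.span {s})) {x : A} (hx : x ∈ A⁰)
    (hxP : algebraMap A B x ∈ P) :
    ∃ _ : IsDomain (Localization.AtPrime (P.comap (algebraMap A B))),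
      IsDiscreteValuationRing (Localization.AtPrime (P.comap (algebraMap A B))) := by
  have hxB : algebraMap A B x ∈ B⁰ := nonZeroDivisors_le_comap_of_flat A B hx
  obtain ⟨Q, hQ, hle⟩ := exists_isAssociatedPrime_comap_le
    (isAssociatedPrime_quotient_span_singleton_of_mem hs hxB hxP hP)
  have := hQ.isPrime
  obtain ⟨_, _⟩ := isDiscreteValuationRing_localization_of_isIntegrallyClosed hx hQ
  obtain rfl := eq_of_le_of_isDiscreteValuationRing_localization hle hx hxP
  exact isDiscreteValuationRing_localization_of_isIntegrallyClosed hx hQ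

theorem isDiscreteValuationRing_localization_of_mem [IsIntegrallyClosed A] {P : Ideal B}
    [P.IsPrime] [IsRegularLocalRing (LocalFibre (algebraMap A B) P)] {s : B} (hs : s ∈ B⁰)
    (hP : IsAssociatedPrime P (B ⧸ Ideal.span {s})) {x : A} (hx : x ∈ A⁰)
    (hxP : algebraMap A B x ∈ P) :
    ∃ _ : IsDomain (Localization.AtPrime P), IsDiscreteValuationRing (Localization.AtPrime P) := by
  obtain ⟨_, _⟩ := isDiscreteValuationRing_localization_comap hs hP hx hxP
  obtain ⟨ϖ, hϖ⟩ := IsDiscreteValuationRing.exists_irreducible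
    (Localization.AtPrime (P.comap (algebraMap A B)))
  have hmap := map_comap_eq_span_localRingHom hϖ.maximalIdeal_eq
  set φ := Localization.localRingHom (P.comap (algebraMap A B)) P (algebraMap A B) rfl
  have hreg : φ ϖ ∈ (Localization.AtPrime P)⁰ := by
    have hdvd : φ ϖ ∣ algebraMap B (Localization.AtPrime P) (algebraMap A B x) := by
      rw [← Ideal.mem_span_singleton, ← hmap]
      exact Ideal.mem_map_of_mem ((algebraMap B (Localization.AtPrime P)).comp (algebraMap A B)) hxP
    obtain ⟨d, hd⟩ := hdvd
    have hxreg := nonZeroDivisors_le_comap_of_flat B (Localization.AtPrime P)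
      (nonZeroDivisors_le_comap_of_flat A B hx)
    rw [Submonoid.mem_comap, hd] at hxreg
    exact (mul_mem_nonZeroDivisors.1 hxreg).1
  refine isDiscreteValuationRing_of_isAssociatedPrime_maximalIdeal
    (nonZeroDivisors_le_comap_of_flat B _ hs) (isAssociatedPrime_maximalIdeal_localization hP)
    hreg ?_
  rw [← hmap, ← Ideal.Quotient.isDomain_iff_prime]
  exact isDomain_of_isRegularLocalRing (LocalFibre (algebraMap A B) P)

theorem isIntegrallyClosed_of_isRegularLocalRing_localFibre [IsReduced A] [IsIntegrallyClosed A]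
    (hfib : ∀ (P : Ideal B) [P.IsPrime], IsRegularLocalRing (LocalFibre (algebraMap A B) P)) :
    IsIntegrallyClosed B := by
  refine isIntegrallyClosed_of_forall_localization fun s hs P _ hP => ?_
  have := hfib P
  obtain ⟨_, _⟩ : ∃ _ : IsDomain (Localization.AtPrime P),
      IsDiscreteValuationRing (Localization.AtPrime P) := by
    by_cases hdisj : Disjoint (P.comap (algebraMap A B) : Set A) A⁰
    · exact isDiscreteValuationRing_localization_of_disjoint hs hP hdisj
    · obtain ⟨x, hxP, hx⟩ := Set.not_disjoint_iff.1 hdisj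
      exact isDiscreteValuationRing_localization_of_mem hs hP hx hxP
  infer_instance

end RegularLocalFibres

section StrictClosure

variable {R A A' : Type*} [CommRing R] [CommRing A] [CommRing A'] [Algebra R A] [Algebra R A']

theorem map_mem_strictClosureIn (f : A →ₐ[R] A') {α : A} (hα : α ∈ strictClosureIn R A) :
    f α ∈ strictClosureIn R A' := by
  rw [mem_strictClosureIn_iff] at hα ⊢
  simpa using congrArg (Algebra.TensorProduct.map f f) hα

theorem strictClosureIn_map_algEquiv (e : A ≃ₐ[R] A') :
    (strictClosureIn R A).map (e : A →ₐ[R] A') = strictClosureIn R A' := by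
  refine le_antisymm ?_ fun α hα => ?_
  · rintro _ ⟨α, hα, rfl⟩
    exact map_mem_strictClosureIn (e : A →ₐ[R] A') hα
  · exact ⟨e.symm α, map_mem_strictClosureIn (e.symm : A' →ₐ[R] A) hα, e.apply_symm_apply α⟩

variable (S : Type*) [CommRing S] [Algebra R S]

variable (R A) in
theorem strictClosureIn_tensorProduct [Module.Flat R S] :
    strictClosureIn S (S ⊗[R] A) = (strictClosureIn R A).baseChange S := by
  have hexact : Function.Exact (Subalgebra.toSubmodule (strictClosureIn R A)).subtype
      (Algebra.TensorProduct.includeLeftSubRight R A) := by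
    rw [LinearMap.exact_iff, Submodule.range_subtype]
    ext α
    rw [LinearMap.mem_ker, Algebra.TensorProduct.includeLeftSubRight_apply, sub_eq_zero]
    rfl
  ext x
  rw [mem_strictClosureIn_iff, ← sub_eq_zero,
    ← Algebra.TensorProduct.includeLeftSubRight_apply,
    ← Algebra.TensorProduct.distribBaseChange_includeLeftSubRight_apply,
    LinearEquiv.map_eq_zero_iff]
  exact Module.Flat.lTensor_exact S hexact x

theorem baseChange_range (f : A →ₐ[R] A') :
    f.range.baseChange S = (Algebra.TensorProduct.map (AlgHom.id S S) f).range := by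
  have hcomp : Algebra.TensorProduct.map (AlgHom.id S S) f =
      (Algebra.TensorProduct.map (AlgHom.id S S) f.range.val).comp
        (Algebra.TensorProduct.map (AlgHom.id S S) f.rangeRestrict) := by
    rw [← Algebra.TensorProduct.map_id_comp, AlgHom.val_comp_rangeRestrict]
  have hsurj : Function.Surjective
      (Algebra.TensorProduct.map (AlgHom.id S S) f.rangeRestrict) :=
    LinearMap.lTensor_surjective S f.rangeRestrict_surjective
  rw [hcomp, AlgHom.range_comp, (AlgHom.range_eq_top _).2 hsurj, Algebra.map_top]
  rfl

theorem baseChange_map_subalgebra (f : A →ₐ[R] A') (C : Subalgebra R A) :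
    (C.map f).baseChange S =
      (C.baseChange S).map (Algebra.TensorProduct.map (AlgHom.id S S) f) := by
  rw [← Subalgebra.range_comp_val, baseChange_range, Algebra.TensorProduct.map_id_comp,
    AlgHom.range_comp]
  rfl

theorem baseChange_bot_subalgebra : (⊥ : Subalgebra R A).baseChange S = ⊥ := by
  rw [← Algebra.range_ofId, baseChange_range, eq_bot_iff]
  rintro _ ⟨y, rfl⟩
  obtain ⟨s, rfl⟩ := (Algebra.TensorProduct.rid R S S).symm.surjective y
  exact Algebra.mem_bot.2 ⟨s, by simp⟩

theorem baseChange_eq_bot_iff_of_faithfullyFlat [Module.FaithfullyFlat R S]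
    {C : Subalgebra R A} : C.baseChange S = ⊥ ↔ C = ⊥ := by
  refine ⟨fun hC => ?_, fun hC => hC ▸ baseChange_bot_subalgebra S⟩
  rw [← baseChange_bot_subalgebra S] at hC
  exact Subalgebra.toSubmodule_injective
    (Submodule.baseChange_injective (A := S) (congrArg Subalgebra.toSubmodule hC))

end StrictClosure

section FractionRing

theorem isFractionRing_of_injective (R T K : Type*) [CommRing R] [CommRing T] [CommRing K]
    [Algebra R K] [Algebra R T] [Algebra T K] [IsScalarTower R T K] [IsFractionRing R K]
    (hT : Function.Injective (algebraMap T K)) : IsFractionRing T K where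
  map_units := by
    rintro ⟨x, hx⟩
    obtain ⟨⟨r, u⟩, hru⟩ := IsLocalization.surj R⁰ (algebraMap T K x)
    have hr : r ∈ R⁰ := mem_nonZeroDivisors_iff_right.2 fun a ha => by
      have hax : algebraMap R T a * x = 0 := by
        apply hT
        rw [map_zero, ← (IsLocalization.map_units K u).mul_left_eq_zero, map_mul, mul_assoc, hru,
          ← IsScalarTower.algebraMap_apply, ← map_mul, ha, map_zero]
      apply IsFractionRing.injective R K
      rw [map_zero, IsScalarTower.algebraMap_apply R T K,
        mem_nonZeroDivisors_iff_right.1 hx _ hax, map_zero]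
    exact isUnit_of_mul_isUnit_left (hru ▸ IsLocalization.map_units K (⟨r, hr⟩ : R⁰))
  surj z := by
    obtain ⟨⟨r, u⟩, hru⟩ := IsLocalization.surj R⁰ z
    rw [IsScalarTower.algebraMap_apply R T K, IsScalarTower.algebraMap_apply R T K] at hru
    refine ⟨⟨algebraMap R T r, ⟨algebraMap R T u, ?_⟩⟩, hru⟩
    refine mem_nonZeroDivisors_iff_right.2 fun a ha => hT ?_
    rw [map_zero, ← (IsLocalization.map_units K u).mul_left_eq_zero,
      IsScalarTower.algebraMap_apply R T K, ← map_mul, ha, map_zero]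
  exists_of_eq h := ⟨1, by rw [hT h]⟩

theorem isIntegrallyClosed_integralClosure (R K : Type*) [CommRing R] [CommRing K] [Algebra R K]
    [IsFractionRing R K] : IsIntegrallyClosed (integralClosure R K) :=
  have := isFractionRing_of_injective R (integralClosure R K) K Subtype.val_injective
  (isIntegrallyClosed_iff_isIntegrallyClosedIn K).2 inferInstance

theorem range_eq_integralClosure {S B K : Type*} [CommRing S] [CommRing B] [CommRing K]
    [Algebra S B] [Algebra S K] [IsFractionRing S K] [Algebra.IsIntegral S B]
    [IsIntegrallyClosed B] {γ : B →ₐ[S] K} (hγ : Function.Injective γ) :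
    γ.range = integralClosure S K := by
  let : Algebra B K := γ.toRingHom.toAlgebra
  have : IsScalarTower S B K := IsScalarTower.of_algebraMap_eq fun s => (γ.commutes s).symm
  have := isFractionRing_of_injective S B K hγ
  ext z
  exact (IsIntegralClosure.isIntegral_iff (A := B)).symm

end FractionRing

section BaseChange

theorem isNoetherianRing_of_faithfullyFlat (A B : Type*) [CommRing A] [CommRing B] [Algebra A B]
    [Module.FaithfullyFlat A B] [IsNoetherianRing B] : IsNoetherianRing A :=
  Submodule.IsNoetherian.of_isNoetherian_tensorProduct_of_faithfullyFlat (A := B)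
    (isNoetherian_of_linearEquiv
      (Algebra.TensorProduct.rid A B B).symm.toLinearEquiv)

/-- The condition on `R → S` at one `R`-algebra `A`: all local fibres of the base change
`A → S ⊗[R] A` are regular. -/
def HasRegularLocalFibresOver (R S A : Type*) [CommRing R] [CommRing S] [CommRing A] [Algebra R S]
    [Algebra R A] : Prop :=
  ∀ (P : Ideal (S ⊗[R] A)) [P.IsPrime], IsRegularLocalRing
    (LocalFibre (Algebra.TensorProduct.includeRight : A →ₐ[R] S ⊗[R] A).toRingHom P)

theorem isReduced_and_isIntegrallyClosed_tensorProduct {R S A : Type*} [CommRing R] [CommRing S]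
    [CommRing A] [Algebra R S] [Algebra R A] [Module.FaithfullyFlat R S] [IsReduced A]
    [IsIntegrallyClosed A] [IsNoetherianRing (S ⊗[R] A)]
    (hfib : HasRegularLocalFibresOver R S A) :
    IsReduced (S ⊗[R] A) ∧ IsIntegrallyClosed (S ⊗[R] A) := by
  let : Algebra A (S ⊗[R] A) := Algebra.TensorProduct.rightAlgebra
  have : Module.FaithfullyFlat A (S ⊗[R] A) := Module.FaithfullyFlat.of_linearEquiv _ _
    (Algebra.TensorProduct.commRight R A S).symm.toLinearEquiv
  have := isNoetherianRing_of_faithfullyFlat A (S ⊗[R] A)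
  exact ⟨isReduced_of_isRegularLocalRing_localFibre (A := A) hfib,
    isIntegrallyClosed_of_isRegularLocalRing_localFibre (A := A) hfib⟩

end BaseChange

section Normalization

variable (R S : Type*) [CommRing R] [CommRing S] [Algebra R S]

theorem tensorFractionRingMap_injective [Module.Flat R S] :
    Function.Injective (tensorFractionRingMap R S) := by
  rw [injective_iff_map_eq_zero]
  intro x hx
  obtain ⟨⟨s, m⟩, hsm⟩ := IsLocalization.surj (Algebra.algebraMapSubmonoid S R⁰) x
  have hs : algebraMap S (FractionRing S) s = 0 := by
    have := congrArg (tensorFractionRingMap R S) hsm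
    rw [map_mul, hx, zero_mul, AlgHom.commutes] at this
    exact this.symm
  have hs0 : s = 0 := IsFractionRing.injective S (FractionRing S) (by rw [hs, map_zero])
  have hm := IsLocalization.map_units (S ⊗[R] FractionRing R) m
  rw [← hm.mul_left_eq_zero, hsm, hs0, map_zero]

/-- The canonical map `S ⊗[R] normalization R → Q(S)`, `s ⊗ x ↦ s * x`, which embeds the base
change of the normalization of `R` into the total ring of fractions of `S`. -/
noncomputable def tensorNormalizationMap [Module.Flat R S] :
    S ⊗[R] normalization R →ₐ[S] FractionRing S :=
  (tensorFractionRingMap R S).comp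
    (Algebra.TensorProduct.map (AlgHom.id S S) (normalization R).val)

theorem tensorNormalizationMap_injective [Module.Flat R S] :
    Function.Injective (tensorNormalizationMap R S) :=
  (tensorFractionRingMap_injective R S).comp
    (Module.Flat.lTensor_preserves_injective_linearMap (M := S)
      (normalization R).val.toLinearMap Subtype.val_injective)

theorem range_tensorNormalizationMap [Module.Flat R S] :
    (tensorNormalizationMap R S).range =
      ((normalization R).baseChange S).map (tensorFractionRingMap R S) :=
  AlgHom.range_comp _ _

variable {R S}

theorem isReduced_of_isReduced_tensorProduct_normalization [Module.Flat R S]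
    [IsReduced (S ⊗[R] normalization R)] : IsReduced S := by
  have hinj : Function.Injective (tensorNormalizationMap R S ∘ algebraMap S _) := by
    rw [← RingHom.coe_coe, ← RingHom.coe_comp, AlgHom.comp_algebraMap]
    exact IsFractionRing.injective S (FractionRing S)
  exact isReduced_of_injective _ hinj.of_comp

/-- The isomorphism from the base change of the normalization of `R` to the normalization of `S`
given by `tensorNormalizationMap`, when the latter is the image of that map. -/
noncomputable def tensorNormalizationEquiv [Module.Flat R S]
    (h : (tensorNormalizationMap R S).range = normalization S) :
    S ⊗[R] normalization R ≃ₐ[S] normalization S :=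
  (AlgEquiv.ofInjective _ (tensorNormalizationMap_injective R S)).trans
    (Subalgebra.equivOfEq _ _ h)

theorem strictClosureIn_normalization_eq_map [Module.Flat R S]
    (h : (tensorNormalizationMap R S).range = normalization S) :
    strictClosureIn S (normalization S) =
      ((strictClosureIn R (normalization R)).baseChange S).map
        (tensorNormalizationEquiv h : S ⊗[R] normalization R →ₐ[S] normalization S) := by
  rw [← strictClosureIn_tensorProduct, strictClosureIn_map_algEquiv]

theorem map_baseChange_strictClosure [Module.Flat R S]
    (h : (tensorNormalizationMap R S).range = normalization S) :
    ((strictClosure R).baseChange S).map (tensorFractionRingMap R S) = strictClosure S := by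
  rw [strictClosure, strictClosure, strictClosureIn_normalization_eq_map h,
    baseChange_map_subalgebra, Subalgebra.map_map, Subalgebra.map_map]
  rfl

theorem isStrictlyClosed_iff_of_faithfullyFlat [Module.FaithfullyFlat R S]
    (h : (tensorNormalizationMap R S).range = normalization S) :
    IsStrictlyClosed R ↔ IsStrictlyClosed S := by
  rw [IsStrictlyClosed, IsStrictlyClosed, IsStrictlyClosedIn, IsStrictlyClosedIn,
    strictClosureIn_normalization_eq_map h, ← baseChange_eq_bot_iff_of_faithfullyFlat S,
    ← Algebra.map_bot (tensorNormalizationEquiv h : S ⊗[R] normalization R →ₐ[S] normalization S)]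
  exact (Subalgebra.map_injective (tensorNormalizationEquiv h).injective).eq_iff.symm

end Normalization

theorem theorem3p1_general {R S : Type*} [CommRing R] [CommRing S] [Algebra R S]
    [Module.FaithfullyFlat R S] [IsReduced R] [IsNoetherianRing (S ⊗[R] normalization R)]
    (hfib : HasRegularLocalFibresOver R S (normalization R)) :
    IsReduced S ∧
    Function.Injective (tensorFractionRingMap R S) ∧
    ((normalization R).baseChange S).map (tensorFractionRingMap R S) = normalization S ∧
    ((strictClosure R).baseChange S).map (tensorFractionRingMap R S) = strictClosure S ∧
    (IsStrictlyClosed R ↔ IsStrictlyClosed S) := by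
  have : IsReduced (normalization R) :=
    isReduced_of_injective (normalization R).val Subtype.val_injective
  have := isIntegrallyClosed_integralClosure R (FractionRing R)
  obtain ⟨_, _⟩ := isReduced_and_isIntegrallyClosed_tensorProduct hfib
  have hrange : (tensorNormalizationMap R S).range = normalization S :=
    range_eq_integralClosure (tensorNormalizationMap_injective R S)
  exact ⟨isReduced_of_isReduced_tensorProduct_normalization (R := R),
    tensorFractionRingMap_injective R S,
    (range_tensorNormalizationMap R S).symm.trans hrange,
    map_baseChange_strictClosure hrange, isStrictlyClosed_iff_of_faithfullyFlat hrange⟩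

theorem theorem3p1 {R : Type u} {S : Type v} [CommRing R] [CommRing S]
    [IsNoetherianRing R] [IsNoetherianRing S] [Algebra R S] [Module.FaithfullyFlat R S]
    (hfib : ∀ (R' : Type u) [CommRing R'] [Algebra R R'] [Module.Finite R R']
      (P : Ideal (S ⊗[R] R')) [P.IsPrime],
      IsRegularLocalRing
        (LocalFibre (Algebra.TensorProduct.includeRight : R' →ₐ[R] S ⊗[R] R').toRingHom P))
    [IsReduced R] [Module.Finite R (normalization R)] :
    IsReduced S ∧
    Function.Injective (tensorFractionRingMap R S) ∧
    ((normalization R).baseChange S).map (tensorFractionRingMap R S) = normalization S ∧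
    ((strictClosure R).baseChange S).map (tensorFractionRingMap R S) = strictClosure S ∧
    (IsStrictlyClosed R ↔ IsStrictlyClosed S) := by
  have := IsNoetherianRing.of_finite S (S ⊗[R] normalization R)
  exact theorem3p1_general fun P _ => hfib (normalization R) P
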